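/- Let $n$ be a natural number, let $d\ge 2$ be an even integer, and let $f:\mathbb R^n\to[0,+\infty)$ be a log-concave function (i.e. $f((1-\theta)x+\theta y)\ge f(x)^{1-\theta}f(y)^{\theta}$ for all $x,y\in\mathbb R^n$, $\theta\in(0,1)$) with $\|f\|_\infty=\sup f=f(0)=1$ and $\int_{\mathbb R^n} f(x)\,dx>0$. Assume that the set $$\widehat H_1(f)=\bigcup_{\lambda\in(0,1)}\left(\log(1/\lambda)\right)^{-1/d}\{x\in\mathbb R^n: f(x)\ge\lambda\}$$ is bounded. Let $\mathbf H_d(\mathbb R^n)$ be the vector space of real homogeneous polynomials of degree $d$ in $n$ variables (including the zero polynomial). Then the problem of minimizing $$\int_{\mathbb R^n} t\,e^{-g(x)}\,dx\in(0,+\infty]$$ among all pairs $(t,g)$ with $t\ge 1$, $g\in\mathbf H_d(\mathbb R^n)$ and $f(x)\le t\,e^{-g(x)}$ for every $x\in\mathbb R^n$ has exactly one solution $(t_2,g_2)$. Moreover, $g_2$ is such that the set $\{x\in\mathbb R^n: g_2(x)\le 1\}$ has finite Lebesgue measure. -/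

import Mathlib

open MeasureTheory Set
open scoped Pointwise ENNReal

/-- A function `f : ℝⁿ → [0, ∞)` is log-concave if
`f ((1 - θ) x + θ y) ≥ f x ^ (1 - θ) * f y ^ θ` for all `x`, `y` and `θ ∈ (0, 1)`
(equivalently `f = exp (-u)` with `u : ℝⁿ → (-∞, ∞]` convex). -/
structure IsLogConcave {n : ℕ} (f : (Fin n → ℝ) → ℝ) : Prop where
  nonneg : ∀ x, 0 ≤ f x
  le : ∀ x y : Fin n → ℝ, ∀ θ ∈ Ioo (0 : ℝ) 1,
    f x ^ (1 - θ) * f y ^ θ ≤ f ((1 - θ) • x + θ • y)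

/-- The superlevel set `K_l(f) = {x | f x ≥ l}`. -/
def superlevel {n : ℕ} (f : (Fin n → ℝ) → ℝ) (l : ℝ) : Set (Fin n → ℝ) :=
  {x | l ≤ f x}

/-- The set `Ĥ₁(f) = ⋃_{l ∈ (0,1)} (log (1 / l)) ^ (-1/d) • {x | f x ≥ l}`. -/
noncomputable def hatH1 {n : ℕ} (d : ℕ) (f : (Fin n → ℝ) → ℝ) : Set (Fin n → ℝ) :=
  ⋃ l ∈ Ioo (0 : ℝ) 1, (Real.log (1 / l) ^ (-1 / (d : ℝ))) • superlevel f l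

/-- The sublevel set `G₁(g) = {x | g x ≤ 1}` of a polynomial. -/
def sublevelOne {n : ℕ} (g : MvPolynomial (Fin n) ℝ) : Set (Fin n → ℝ) :=
  {x | MvPolynomial.eval x g ≤ 1}

/-- The set `𝔽_d(ℝⁿ)` of the homogeneous polynomials `g` of degree `d` (the zero polynomial is
counted as homogeneous of every degree) for which `G₁(g)` has finite Lebesgue measure. -/
def finiteVolumeForms (n d : ℕ) : Set (MvPolynomial (Fin n) ℝ) :=
  {g | g ∈ MvPolynomial.homogeneousSubmodule (Fin n) ℝ d ∧ volume (sublevelOne g) < ∞}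

/-- The functional `∫ t e^{-g(x)} dx`, with value `∞` when the integral diverges. -/
noncomputable def objective {n : ℕ} (t : ℝ) (g : MvPolynomial (Fin n) ℝ) : ℝ≥0∞ :=
  ∫⁻ x : Fin n → ℝ, ENNReal.ofReal (t * Real.exp (-MvPolynomial.eval x g))

/-- `(t, g)` is feasible for `f`: `t ≥ 1`, `g` is homogeneous of degree `d`, and
`f ≤ t e^{-g}` pointwise. -/
structure IsFeasible {n : ℕ} (d : ℕ) (f : (Fin n → ℝ) → ℝ) (t : ℝ)
    (g : MvPolynomial (Fin n) ℝ) : Prop where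
  one_le : 1 ≤ t
  homogeneous : g ∈ MvPolynomial.homogeneousSubmodule (Fin n) ℝ d
  bound : ∀ x, f x ≤ t * Real.exp (-MvPolynomial.eval x g)

/-- `(t, g)` minimizes `∫ t e^{-g}` among all feasible pairs. -/
structure IsMinimizer {n : ℕ} (d : ℕ) (f : (Fin n → ℝ) → ℝ) (t : ℝ)
    (g : MvPolynomial (Fin n) ℝ) : Prop where
  feasible : IsFeasible d f t g
  le : ∀ (s : ℝ) (h : MvPolynomial (Fin n) ℝ), IsFeasible d f s h → objective t g ≤ objective s h

/-! Existence is a compactness argument. Boundedness of `hatH1 d f` means `f ≤ exp (-‖x‖ ^ d / R)`,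
so `t = 1` with a multiple of `∑ xᵢ ^ d` is feasible with finite objective. Log-concavity and a
positive integral give a ball on which `f ≥ c > 0`. Any feasible pair of finite objective has `g ≥
0`, and `g ≤ log (t / c)` on that ball; this controls the coefficients of `g` by `log (t / c)`, and
the objective then controls `t` (`exists_bound_of_objective_le`). The objective is lower
semicontinuous by Fatou, so it attains its minimum.

Uniqueness is strict AM-GM: the geometric mean of two minimizers is again feasible, and its integral
is smaller unless the two functions coincide. -/

/-! ### Homogeneous polynomials and finiteness of the objective -/

theorem eval_smul_of_homogeneous {n d : ℕ} {g : MvPolynomial (Fin n) ℝ}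
    (hg : g ∈ MvPolynomial.homogeneousSubmodule (Fin n) ℝ d) (c : ℝ) (x : Fin n → ℝ) :
    MvPolynomial.eval (c • x) g = c ^ d * MvPolynomial.eval x g := by
  rw [MvPolynomial.mem_homogeneousSubmodule] at hg
  rw [MvPolynomial.eval_eq', MvPolynomial.eval_eq', Finset.mul_sum]
  refine Finset.sum_congr rfl fun s hs => ?_
  have hdeg : s.degree = d := by
    rw [Finsupp.degree_eq_weight_one]
    exact hg (MvPolynomial.mem_support_iff.mp hs)
  have h : ∏ i, c ^ s i = c ^ d := by
    rw [Finset.prod_pow_eq_pow_sum, ← hdeg, Finsupp.degree_eq_sum]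
  simp only [Pi.smul_apply, smul_eq_mul, mul_pow, Finset.prod_mul_distrib, h]
  ring

theorem eval_zero_of_homogeneous {n d : ℕ} (hd : 0 < d) {g : MvPolynomial (Fin n) ℝ}
    (hg : g ∈ MvPolynomial.homogeneousSubmodule (Fin n) ℝ d) :
    MvPolynomial.eval (0 : Fin n → ℝ) g = 0 := by
  simpa [hd.ne'] using eval_smul_of_homogeneous hg 0 0

theorem continuous_eval_mvPolynomial {n : ℕ} (g : MvPolynomial (Fin n) ℝ) :
    Continuous fun x : Fin n → ℝ => MvPolynomial.eval x g :=
  MvPolynomial.continuous_eval g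

theorem continuous_integrand {n : ℕ} (t : ℝ) (g : MvPolynomial (Fin n) ℝ) :
    Continuous fun x : Fin n → ℝ => ENNReal.ofReal (t * Real.exp (-MvPolynomial.eval x g)) :=
  ENNReal.continuous_ofReal.comp
    (continuous_const.mul (Real.continuous_exp.comp (continuous_eval_mvPolynomial g).neg))

/-- Lower bound for the objective in terms of the volume of a set on which `g` is bounded above. -/
theorem mul_volume_le_objective {n : ℕ} {t : ℝ} (ht : 0 ≤ t) (g : MvPolynomial (Fin n) ℝ)
    (M : ℝ) {s : Set (Fin n → ℝ)} (hs : ∀ x ∈ s, MvPolynomial.eval x g ≤ M) :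
    ENNReal.ofReal (t * Real.exp (-M)) * volume s ≤ objective t g := by
  refine le_trans ?_ (mul_meas_ge_le_lintegral₀ (continuous_integrand t g).aemeasurable
    (ENNReal.ofReal (t * Real.exp (-M))))
  gcongr
  intro x hx
  exact ENNReal.ofReal_le_ofReal
    (mul_le_mul_of_nonneg_left (Real.exp_le_exp.2 (neg_le_neg (hs x hx))) ht)

theorem volume_lt_top_of_objective_lt_top {n : ℕ} {t : ℝ} (ht : 1 ≤ t)
    {g : MvPolynomial (Fin n) ℝ} (hfin : objective t g < ∞) (M : ℝ) {s : Set (Fin n → ℝ)}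
    (hs : ∀ x ∈ s, MvPolynomial.eval x g ≤ M) : volume s < ∞ := by
  have h := (mul_volume_le_objective (zero_le_one.trans ht) g M hs).trans_lt hfin
  refine ENNReal.lt_top_of_mul_ne_top_right h.ne ?_
  have : 0 < t * Real.exp (-M) := mul_pos (by linarith) (Real.exp_pos _)
  simpa using this

/-- The set where `g < 0` is an open cone. If nonempty, it has positive measure, and finite measure
since the integrand exceeds `t` there; but doubling maps it into itself and multiplies its measure
by `2 ^ n`. -/
theorem eval_nonneg_of_objective_lt_top {n d : ℕ} (hd : 0 < d) {t : ℝ} (ht : 1 ≤ t)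
    {g : MvPolynomial (Fin n) ℝ} (hg : g ∈ MvPolynomial.homogeneousSubmodule (Fin n) ℝ d)
    (hfin : objective t g < ∞) (x : Fin n → ℝ) : 0 ≤ MvPolynomial.eval x g := by
  by_contra! hx
  have hn : n ≠ 0 := by
    rintro rfl
    rw [Subsingleton.elim x 0, eval_zero_of_homogeneous hd hg] at hx
    exact hx.false
  set s : Set (Fin n → ℝ) := {y | MvPolynomial.eval y g < 0} with hs
  have hopen : IsOpen s := isOpen_lt (continuous_eval_mvPolynomial g) continuous_const
  have hpos : 0 < volume s := hopen.measure_pos volume ⟨x, hx⟩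
  have hlt : volume s < ∞ := volume_lt_top_of_objective_lt_top ht hfin 0 fun y hy => le_of_lt hy
  have hsub : (2 : ℝ) • s ⊆ s := by
    rintro _ ⟨y, hy, rfl⟩
    change MvPolynomial.eval ((2 : ℝ) • y) g < 0
    rw [eval_smul_of_homogeneous hg]
    exact mul_neg_of_pos_of_neg (by positivity) hy
  have h := measure_mono (μ := volume) hsub
  rw [Measure.addHaar_smul] at h
  have h1 : (1 : ℝ≥0∞) < ENNReal.ofReal |(2 : ℝ) ^ Module.finrank ℝ (Fin n → ℝ)| := by
    rw [ENNReal.one_lt_ofReal, abs_of_pos (by positivity)]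
    exact one_lt_pow₀ one_lt_two (by simpa using hn)
  have h2 := ENNReal.mul_lt_mul_left hpos.ne' hlt.ne h1
  rw [one_mul] at h2
  exact absurd h (not_le.2 h2)

/-! ### Lower and upper bounds for `f` -/

theorem IsLogConcave.convex_superlevel {n : ℕ} {f : (Fin n → ℝ) → ℝ} (hf : IsLogConcave f)
    {c : ℝ} (hc : 0 < c) : Convex ℝ (superlevel f c) := by
  rw [convex_iff_forall_pos]
  intro x hx y hy a b ha hb hab
  have h := hf.le x y b ⟨hb, by linarith⟩
  have ha' : 1 - b = a := by linarith
  rw [ha'] at h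
  refine le_trans ?_ h
  calc c = c ^ a * c ^ b := by rw [← Real.rpow_add hc, hab, Real.rpow_one]
    _ ≤ f x ^ a * f y ^ b := mul_le_mul (Real.rpow_le_rpow hc.le hx ha.le)
        (Real.rpow_le_rpow hc.le hy hb.le) (by positivity) (Real.rpow_nonneg (hf.nonneg _) _)

/-- A log-concave function with positive integral is bounded below on some ball. -/
theorem IsLogConcave.exists_closedBall_le {n : ℕ} {f : (Fin n → ℝ) → ℝ} (hf : IsLogConcave f)
    (hint : 0 < ∫⁻ x, ENNReal.ofReal (f x)) :
    ∃ x₀ : Fin n → ℝ, ∃ r > 0, ∃ c > 0, ∀ x ∈ Metric.closedBall x₀ r, c ≤ f x := by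
  obtain ⟨k, hk⟩ : ∃ k : ℕ, volume (superlevel f (1 / ((k : ℝ) + 1))) ≠ 0 := by
    by_contra! h
    have h0 : ∀ᵐ x, ∀ k : ℕ, x ∉ superlevel f (1 / ((k : ℝ) + 1)) :=
      ae_all_iff.2 fun k => measure_eq_zero_iff_ae_notMem.1 (h k)
    refine hint.ne' ?_
    rw [lintegral_congr_ae (g := fun _ => 0), lintegral_zero]
    filter_upwards [h0] with x hx
    rw [ENNReal.ofReal_eq_zero]
    by_contra! hpos
    obtain ⟨k, hk⟩ := exists_nat_one_div_lt hpos
    exact hx k hk.le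
  have hc : (0 : ℝ) < 1 / ((k : ℝ) + 1) := by positivity
  have hne : (interior (superlevel f (1 / ((k : ℝ) + 1)))).Nonempty := by
    rw [nonempty_iff_ne_empty]
    intro he
    -- A convex set has null frontier, so one with empty interior is null.
    refine hk (measure_mono_null ?_ ((hf.convex_superlevel hc).addHaar_frontier volume))
    rw [frontier, he, sdiff_empty]
    exact subset_closure
  obtain ⟨x₀, hx₀⟩ := hne
  obtain ⟨r, hr, hsub⟩ := Metric.nhds_basis_closedBall.mem_iff.1 (mem_interior_iff_mem_nhds.1 hx₀)
  exact ⟨x₀, r, hr, _, hc, fun x hx => hsub hx⟩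

theorem exp_neg_le_of_isBounded_hatH1 {n d : ℕ} (hd0 : 0 < d) {f : (Fin n → ℝ) → ℝ}
    (hle : ∀ x, f x ≤ 1) (hbdd : Bornology.IsBounded (hatH1 d f)) :
    ∃ R > 0, ∀ x, f x ≤ Real.exp (-(‖x‖ ^ d / R)) := by
  obtain ⟨R, hR, hsub⟩ := hbdd.subset_closedBall_lt 0 0
  have key : ∀ l ∈ Ioo (0 : ℝ) 1, ∀ x, l ≤ f x → ‖x‖ ^ d ≤ R ^ d * Real.log (1 / l) := by
    intro l hl x hx
    have hlog : 0 < Real.log (1 / l) := Real.log_pos (by rw [lt_div_iff₀ hl.1]; linarith [hl.2])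
    have hmem : (Real.log (1 / l) ^ (-1 / (d : ℝ))) • x ∈ hatH1 d f :=
      mem_iUnion₂.2 ⟨l, hl, smul_mem_smul_set hx⟩
    have h := hsub hmem
    rw [mem_closedBall_zero_iff, norm_smul, Real.norm_of_nonneg (Real.rpow_nonneg hlog.le _)] at h
    have h2 := pow_le_pow_left₀ (by positivity) h d
    rw [mul_pow, ← Real.rpow_natCast, ← Real.rpow_mul hlog.le,
      div_mul_cancel₀ _ (Nat.cast_ne_zero.2 hd0.ne'), Real.rpow_neg_one,
      inv_mul_le_iff₀ hlog] at h2
    linarith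
  refine ⟨R ^ d, by positivity, fun x => ?_⟩
  have hlt : ∀ l ∈ Ioo (0 : ℝ) 1, l ≤ f x → l ≤ Real.exp (-(‖x‖ ^ d / R ^ d)) := by
    intro l hl hx
    have h := key l hl x hx
    rw [← Real.log_le_iff_le_exp hl.1]
    rw [one_div, Real.log_inv] at h
    have : ‖x‖ ^ d / R ^ d ≤ -Real.log l := by
      rw [div_le_iff₀ (by positivity)]; linarith
    linarith
  -- The level `f x` itself may be `0` or `1`, outside the range of `key`, so it is approached from
  -- below.
  refine le_of_forall_lt fun l hl => ?_
  obtain ⟨m, hlm, hm⟩ := exists_between hl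
  rcases le_or_gt m 0 with h0 | h0
  · exact (hlm.trans_le h0).trans (Real.exp_pos _)
  · exact hlm.trans_le (hlt m ⟨h0, hm.trans_le (hle x)⟩ hm.le)

/-! ### A feasible pair of finite objective -/

theorem integrable_exp_neg_mul_even_pow {d : ℕ} (hd : Even d) (hd0 : 0 < d) {c : ℝ} (hc : 0 < c) :
    Integrable fun x : ℝ => Real.exp (-(c * x ^ d)) := by
  refine Integrable.mono' ((integrable_exp_neg_mul_sq hc).const_mul (Real.exp c))
    (by fun_prop) (Filter.Eventually.of_forall fun x => ?_)
  rw [Real.norm_of_nonneg (Real.exp_pos _).le, ← Real.exp_add, Real.exp_le_exp]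
  have h : x ^ 2 - 1 ≤ x ^ d := by
    obtain ⟨k, rfl⟩ := hd
    rw [← two_mul, pow_mul]
    have hk : k ≠ 0 := by omega
    rcases le_total (x ^ 2) 1 with h1 | h1
    · have : 0 ≤ (x ^ 2) ^ k := by positivity
      linarith
    · linarith [le_self_pow₀ h1 hk]
  nlinarith

theorem exists_isFeasible_objective_lt_top {n d : ℕ} (hd : Even d) (hd0 : 0 < d)
    {f : (Fin n → ℝ) → ℝ} (hle : ∀ x, f x ≤ 1)
    (hbdd : Bornology.IsBounded (hatH1 d f)) :
    ∃ g : MvPolynomial (Fin n) ℝ, IsFeasible d f 1 g ∧ objective 1 g < ∞ := by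
  obtain ⟨R, hR, hfR⟩ := exp_neg_le_of_isBounded_hatH1 hd0 hle hbdd
  -- The `n` terms `c * x i ^ d` must add up to at most `‖x‖ ^ d / R`; `n + 1` also covers `n = 0`.
  set c : ℝ := 1 / ((n + 1) * R) with hc
  have hc0 : 0 < c := by positivity
  have heval : ∀ x : Fin n → ℝ,
      MvPolynomial.eval x (MvPolynomial.C c * ∑ i, MvPolynomial.X i ^ d) = ∑ i, c * x i ^ d := by
    intro x
    simp [Finset.mul_sum]
  refine ⟨MvPolynomial.C c * ∑ i, MvPolynomial.X i ^ d, ⟨le_rfl, ?_, fun x => ?_⟩, ?_⟩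
  · rw [MvPolynomial.mem_homogeneousSubmodule]
    have := (MvPolynomial.isHomogeneous_C (Fin n) c).mul
      (MvPolynomial.IsHomogeneous.sum Finset.univ
        (fun i => (MvPolynomial.X i : MvPolynomial (Fin n) ℝ) ^ d) d
        fun i _ => by simpa using (MvPolynomial.isHomogeneous_X ℝ i).pow d)
    rwa [zero_add] at this
  · rw [one_mul, heval]
    refine (hfR x).trans (Real.exp_le_exp.2 (neg_le_neg ?_))
    calc ∑ i, c * x i ^ d ≤ ∑ _i : Fin n, c * ‖x‖ ^ d := by
          refine Finset.sum_le_sum fun i _ => mul_le_mul_of_nonneg_left ?_ hc0.le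
          calc x i ^ d = ‖x i‖ ^ d := (hd.pow_abs _).symm
            _ ≤ ‖x‖ ^ d := by gcongr; exact norm_le_pi_norm x i
      _ = n * (c * ‖x‖ ^ d) := by simp
      _ ≤ (n + 1) * (c * ‖x‖ ^ d) := by gcongr; linarith
      _ = ‖x‖ ^ d / R := by rw [hc]; field_simp
  · have hprod : Integrable fun x : Fin n → ℝ => ∏ i, Real.exp (-(c * x i ^ d)) :=
      Integrable.fintype_prod fun _ => integrable_exp_neg_mul_even_pow hd hd0 hc0
    refine lt_of_eq_of_lt ?_ hprod.lintegral_lt_top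
    unfold objective
    refine lintegral_congr fun x => ?_
    rw [one_mul, heval, ← Real.exp_sum, Finset.sum_neg_distrib]

/-! ### Coordinates on the forms and a priori bounds -/

theorem exists_linear_parametrization_homogeneous (n d : ℕ) :
    ∃ m : ℕ, ∃ P : (Fin m → ℝ) →ₗ[ℝ] MvPolynomial (Fin n) ℝ, Function.Injective P ∧
      LinearMap.range P = MvPolynomial.homogeneousSubmodule (Fin n) ℝ d := by
  have : Module.Finite ℝ (MvPolynomial.homogeneousSubmodule (Fin n) ℝ d) :=
    Module.Finite.iff_fg.2 (MvPolynomial.homogeneousSubmodule_fg _ _ d)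
  let b := Module.finBasis ℝ (MvPolynomial.homogeneousSubmodule (Fin n) ℝ d)
  refine ⟨_, (Submodule.subtype _).comp b.equivFun.symm.toLinearMap,
    (Submodule.subtype_injective _).comp b.equivFun.symm.injective, ?_⟩
  rw [LinearMap.range_comp, LinearEquiv.range, Submodule.map_top, Submodule.range_subtype]

/-- Restriction of a linear family of polynomials to a set, as continuous functions. -/
noncomputable def evalOn {E : Type*} [AddCommGroup E] [Module ℝ E] {n : ℕ}
    (P : E →ₗ[ℝ] MvPolynomial (Fin n) ℝ) (s : Set (Fin n → ℝ)) : E →ₗ[ℝ] C(s, ℝ) where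
  toFun a := ⟨fun x => MvPolynomial.eval x.1 (P a),
    (continuous_eval_mvPolynomial (P a)).comp continuous_subtype_val⟩
  map_add' a b := by ext x; simp
  map_smul' c a := by ext x; simp

/-- A polynomial vanishing on a ball (a product of intervals in the sup norm) is zero, so
restriction to the ball is injective on a finite-dimensional space, hence bounded below. -/
theorem exists_norm_le_of_abs_eval_le {m n : ℕ} {P : (Fin m → ℝ) →ₗ[ℝ] MvPolynomial (Fin n) ℝ}
    (hP : Function.Injective P) (x₀ : Fin n → ℝ) {r : ℝ} (hr : 0 < r) :
    ∃ C > 0, ∀ a, ∀ L, 0 ≤ L →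
      (∀ x ∈ Metric.closedBall x₀ r, |MvPolynomial.eval x (P a)| ≤ L) → ‖a‖ ≤ C * L := by
  have hker : LinearMap.ker (evalOn P (Metric.closedBall x₀ r)) = ⊥ := by
    rw [LinearMap.ker_eq_bot']
    intro a ha
    apply hP
    rw [map_zero]
    refine MvPolynomial.funext_set (fun i => Metric.closedBall (x₀ i) r) (fun i => ?_) ?_
    · rw [Real.closedBall_eq_Icc]
      exact Icc_infinite (by linarith)
    · intro x hx
      rw [← closedBall_pi _ hr.le] at hx
      simpa [evalOn] using DFunLike.congr_fun ha ⟨x, hx⟩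
  obtain ⟨K, hK, hA⟩ := LinearMap.exists_antilipschitzWith _ hker
  refine ⟨K, hK, fun a L hL h => (hA.le_mul_norm (map_zero _) a).trans ?_⟩
  gcongr
  exact (ContinuousMap.norm_le _ hL).2 fun x => h x.1 x.2

theorem exists_abs_eval_le_mul_norm {m n : ℕ} (P : (Fin m → ℝ) →ₗ[ℝ] MvPolynomial (Fin n) ℝ)
    (x₀ : Fin n → ℝ) (r : ℝ) :
    ∃ K ≥ 0, ∀ a, ∀ x ∈ Metric.closedBall x₀ r, |MvPolynomial.eval x (P a)| ≤ K * ‖a‖ := by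
  let T : (Fin m → ℝ) →L[ℝ] C(Metric.closedBall x₀ r, ℝ) :=
    LinearMap.toContinuousLinearMap (evalOn P (Metric.closedBall x₀ r))
  refine ⟨‖T‖, norm_nonneg T, fun a x hx => ?_⟩
  exact ((T a).norm_coe_le_norm ⟨x, hx⟩).trans (T.le_opNorm a)

/-- Feasible pairs whose objective is bounded stay in a bounded set. -/
theorem exists_bound_of_objective_le {m n d : ℕ} (hd0 : 0 < d)
    {P : (Fin m → ℝ) →ₗ[ℝ] MvPolynomial (Fin n) ℝ} (hP : Function.Injective P)
    {f : (Fin n → ℝ) → ℝ} {x₀ : Fin n → ℝ} {r c : ℝ} (hr : 0 < r) (hc : 0 < c)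
    (hfc : ∀ x ∈ Metric.closedBall x₀ r, c ≤ f x) {M : ℝ≥0∞} (hM : M < ∞) :
    ∃ B : ℝ, ∀ t a, IsFeasible d f t (P a) → objective t (P a) ≤ M → t ≤ B ∧ ‖a‖ ≤ B := by
  obtain ⟨C, hC, hCP⟩ := exists_norm_le_of_abs_eval_le hP x₀ hr
  obtain ⟨K, hK, hKP⟩ := exists_abs_eval_le_mul_norm P 0 1
  -- Chosen so that `ρ * (K * C) ≤ 1 / 2`: by homogeneity, `g ≤ L / 2` on the ball of radius `ρ`.
  set ρ : ℝ := 1 / (2 * (K * C) + 1) with hρ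
  have hρ0 : 0 < ρ := by positivity
  have hρ1 : ρ ≤ 1 := by
    rw [hρ, div_le_one (by positivity)]
    linarith [mul_nonneg hK hC.le]
  have hρ2 : ρ * (K * C) ≤ 1 / 2 := by
    rw [hρ, one_div_mul_eq_div, div_le_div_iff₀ (by positivity) two_pos]
    linarith
  set V := volume (Metric.closedBall (0 : Fin n → ℝ) ρ) with hV
  have hV0 : V ≠ 0 := (Metric.measure_closedBall_pos volume _ hρ0).ne'
  set Q : ℝ := (M / V).toReal with hQ
  have hMV : M / V ≠ ∞ := ENNReal.div_ne_top hM.ne hV0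
  refine ⟨max (Q ^ 2 / c) (C * (Q ^ 2 / c / c)), fun t a hfeas hobj => ?_⟩
  have ht0 : 0 < t := zero_lt_one.trans_le hfeas.one_le
  have hnn := eval_nonneg_of_objective_lt_top hd0 hfeas.one_le hfeas.homogeneous
    (hobj.trans_lt hM)
  set L := Real.log (t / c) with hL
  have hexpL : Real.exp L = t / c := Real.exp_log (by positivity)
  have hgL : ∀ x ∈ Metric.closedBall x₀ r, MvPolynomial.eval x (P a) ≤ L := by
    intro x hx
    rw [hL, Real.le_log_iff_exp_le (by positivity), le_div_iff₀ hc]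
    have h := (hfc x hx).trans (hfeas.bound x)
    rwa [Real.exp_neg, ← div_eq_mul_inv, le_div_iff₀ (Real.exp_pos _), mul_comm] at h
  have hL0 : 0 ≤ L := (hnn x₀).trans (hgL x₀ (Metric.mem_closedBall_self hr.le))
  have ha : ‖a‖ ≤ C * L := hCP a L hL0 fun x hx => by
    rw [abs_of_nonneg (hnn x)]
    exact hgL x hx
  have hsmall : ∀ x ∈ Metric.closedBall (0 : Fin n → ℝ) ρ,
      MvPolynomial.eval x (P a) ≤ L / 2 := by
    intro x hx
    have hy : ρ⁻¹ • x ∈ Metric.closedBall (0 : Fin n → ℝ) 1 := by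
      rw [mem_closedBall_zero_iff] at hx ⊢
      rw [norm_smul, norm_inv, Real.norm_of_nonneg hρ0.le, inv_mul_le_iff₀ hρ0, mul_one]
      exact hx
    have hxy : x = ρ • ρ⁻¹ • x := by rw [smul_inv_smul₀ hρ0.ne']
    rw [hxy, eval_smul_of_homogeneous hfeas.homogeneous]
    calc ρ ^ d * MvPolynomial.eval (ρ⁻¹ • x) (P a) ≤ ρ * (K * (C * L)) := by
          have h1 : ρ ^ d ≤ ρ := pow_le_of_le_one hρ0.le hρ1 hd0.ne'
          have h2 : MvPolynomial.eval (ρ⁻¹ • x) (P a) ≤ K * (C * L) :=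
            (le_abs_self _).trans ((hKP a _ hy).trans (by gcongr))
          exact mul_le_mul h1 h2 (hnn _) hρ0.le
      _ = ρ * (K * C) * L := by ring
      _ ≤ 1 / 2 * L := by gcongr
      _ = L / 2 := by ring
  have hvol := (mul_volume_le_objective ht0.le (P a) (L / 2) hsmall).trans hobj
  have htQ : t * Real.exp (-(L / 2)) ≤ Q := by
    rw [hQ, ← ENNReal.ofReal_le_iff_le_toReal hMV]
    exact (ENNReal.le_div_iff_mul_le (Or.inl hV0)
      (Or.inl measure_closedBall_lt_top.ne)).2 hvol
  -- The gain of `1 / 2` is what bounds `t`: `t * exp (-L)` would be the constant `c`, whereas `t *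
  -- exp (-L / 2)` is `√(t * c)`.
  have hsq : (t * Real.exp (-(L / 2))) ^ 2 = t * c := by
    rw [mul_pow, ← Real.exp_nat_mul]
    have : ((2 : ℕ) : ℝ) * (-(L / 2)) = -L := by push_cast; ring
    rw [this, Real.exp_neg, hexpL]
    field_simp
  have htB : t ≤ Q ^ 2 / c := by
    rw [le_div_iff₀ hc, ← hsq]
    exact pow_le_pow_left₀ (by positivity) htQ 2
  refine ⟨htB.trans (le_max_left _ _), ha.trans (le_trans ?_ (le_max_right _ _))⟩
  gcongr
  calc L ≤ t / c := (Real.log_le_sub_one_of_pos (by positivity)).trans (by linarith)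
    _ ≤ Q ^ 2 / c / c := by gcongr

theorem continuous_eval_parametrization {m n : ℕ}
    (P : (Fin m → ℝ) →ₗ[ℝ] MvPolynomial (Fin n) ℝ) (x : Fin n → ℝ) :
    Continuous fun a => MvPolynomial.eval x (P a) :=
  LinearMap.continuous_of_finiteDimensional
    ((MvPolynomial.aeval (R := ℝ) x).toLinearMap.comp P)

/-! ### Existence of a minimizer -/

theorem lowerSemicontinuous_objective {m n : ℕ}
    (P : (Fin m → ℝ) →ₗ[ℝ] MvPolynomial (Fin n) ℝ) :
    LowerSemicontinuous fun p : ℝ × (Fin m → ℝ) => objective p.1 (P p.2) := by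
  rw [lowerSemicontinuous_iff_le_liminf]
  intro p
  refine le_trans (lintegral_mono fun x => ?_)
    (lintegral_liminf_le fun q => (continuous_integrand q.1 (P q.2)).measurable)
  have hcont : Continuous fun q : ℝ × (Fin m → ℝ) =>
      ENNReal.ofReal (q.1 * Real.exp (-MvPolynomial.eval x (P q.2))) :=
    ENNReal.continuous_ofReal.comp (continuous_fst.mul (Real.continuous_exp.comp
      ((continuous_eval_parametrization P x).comp continuous_snd).neg))
  exact (hcont.tendsto p).liminf_eq.ge

theorem exists_isMinimizer {n d : ℕ} (hd0 : 0 < d) {f : (Fin n → ℝ) → ℝ}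
    {x₀ : Fin n → ℝ} {r c : ℝ} (hr : 0 < r) (hc : 0 < c)
    (hfc : ∀ x ∈ Metric.closedBall x₀ r, c ≤ f x) {s : ℝ} {h : MvPolynomial (Fin n) ℝ}
    (hfeas : IsFeasible d f s h) (hfin : objective s h < ∞) :
    ∃ t g, IsMinimizer d f t g := by
  obtain ⟨m, P, hP, hrange⟩ := exists_linear_parametrization_homogeneous n d
  obtain ⟨B, hB⟩ := exists_bound_of_objective_le hd0 hP hr hc hfc hfin
  set S : Set (ℝ × (Fin m → ℝ)) :=
    Metric.closedBall 0 B ∩ {p | IsFeasible d f p.1 (P p.2)} with hS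
  have hclosed : IsClosed {p : ℝ × (Fin m → ℝ) | IsFeasible d f p.1 (P p.2)} := by
    have heq : {p : ℝ × (Fin m → ℝ) | IsFeasible d f p.1 (P p.2)} =
        {p | 1 ≤ p.1} ∩ ⋂ x, {p | f x ≤ p.1 * Real.exp (-MvPolynomial.eval x (P p.2))} := by
      ext p
      simp only [mem_ofPred_eq, mem_inter_iff, mem_iInter]
      exact ⟨fun hp => ⟨hp.one_le, hp.bound⟩,
        fun hp => ⟨hp.1, hrange ▸ LinearMap.mem_range_self P p.2, hp.2⟩⟩
    rw [heq]
    refine (isClosed_le continuous_const continuous_fst).inter (isClosed_iInter fun x => ?_)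
    exact isClosed_le continuous_const (continuous_fst.mul (Real.continuous_exp.comp
      ((continuous_eval_parametrization P x).comp continuous_snd).neg))
  have hcomp : IsCompact S := (isCompact_closedBall 0 B).inter_right hclosed
  have hmemS : ∀ t a, IsFeasible d f t (P a) → objective t (P a) ≤ objective s h →
      (t, a) ∈ S := by
    intro t a hta hle
    refine ⟨?_, hta⟩
    rw [mem_closedBall_zero_iff, Prod.norm_def, sup_le_iff]
    obtain ⟨h1, h2⟩ := hB t a hta hle
    exact ⟨by rwa [Real.norm_of_nonneg (zero_le_one.trans hta.one_le)], h2⟩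
  have hlift : ∀ {g}, g ∈ MvPolynomial.homogeneousSubmodule (Fin n) ℝ d → ∃ a, P a = g := by
    intro g hg
    rwa [← hrange] at hg
  obtain ⟨a, rfl⟩ := hlift hfeas.homogeneous
  have haS := hmemS s a hfeas le_rfl
  obtain ⟨p, hpS, hmin⟩ := LowerSemicontinuousOn.exists_isMinOn ⟨_, haS⟩ hcomp
    ((lowerSemicontinuous_objective P).lowerSemicontinuousOn S)
  refine ⟨p.1, P p.2, hpS.2, fun t g htg => ?_⟩
  obtain ⟨b, rfl⟩ := hlift htg.homogeneous
  rcases le_total (objective t (P b)) (objective s (P a)) with hle | hle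
  · exact isMinOn_iff.1 hmin _ (hmemS t b htg hle)
  · exact (isMinOn_iff.1 hmin _ haS).trans hle

/-! ### Uniqueness -/

theorem IsMinimizer.eq_of_objective_lt_top {n d : ℕ} (hd0 : 0 < d) {f : (Fin n → ℝ) → ℝ}
    (hf : ∀ x, 0 ≤ f x) {t₁ t₂ : ℝ} {g₁ g₂ : MvPolynomial (Fin n) ℝ}
    (h₁ : IsMinimizer d f t₁ g₁) (h₂ : IsMinimizer d f t₂ g₂) (hfin : objective t₂ g₂ < ∞) :
    t₁ = t₂ ∧ g₁ = g₂ := by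
  have ht₁ := h₁.feasible.one_le
  have ht₂ := h₂.feasible.one_le
  set u₁ : (Fin n → ℝ) → ℝ := fun x => t₁ * Real.exp (-MvPolynomial.eval x g₁) with hu₁
  set u₂ : (Fin n → ℝ) → ℝ := fun x => t₂ * Real.exp (-MvPolynomial.eval x g₂) with hu₂
  have hp₁ : ∀ x, 0 < u₁ x := fun x => mul_pos (by linarith) (Real.exp_pos _)
  have hp₂ : ∀ x, 0 < u₂ x := fun x => mul_pos (by linarith) (Real.exp_pos _)
  set g := MvPolynomial.C (1 / 2 : ℝ) * (g₁ + g₂) with hg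
  have hgeo : ∀ x, √(t₁ * t₂) * Real.exp (-MvPolynomial.eval x g) = √(u₁ x * u₂ x) := by
    intro x
    have he : Real.exp (-MvPolynomial.eval x g) =
        √(Real.exp (-MvPolynomial.eval x g₁) * Real.exp (-MvPolynomial.eval x g₂)) := by
      rw [← Real.exp_add, Real.sqrt_eq_rpow, ← Real.exp_mul]
      congr 1
      simp [hg]
      ring
    rw [he, ← Real.sqrt_mul (by positivity)]
    congr 1
    simp only [hu₁, hu₂]
    ring
  have hmid : IsFeasible d f √(t₁ * t₂) g := by
    refine ⟨Real.one_le_sqrt.2 (one_le_mul_of_one_le_of_one_le ht₁ ht₂), ?_, fun x => ?_⟩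
    · rw [hg, ← MvPolynomial.smul_eq_C_mul]
      exact Submodule.smul_mem _ _
        (Submodule.add_mem _ h₁.feasible.homogeneous h₂.feasible.homogeneous)
    · rw [hgeo]
      refine Real.le_sqrt_of_sq_le ?_
      rw [sq]
      exact mul_le_mul (h₁.feasible.bound x) (h₂.feasible.bound x) (hf x) (hp₁ x).le
  have heq : objective t₁ g₁ = objective t₂ g₂ :=
    le_antisymm (h₁.le _ _ h₂.feasible) (h₂.le _ _ h₁.feasible)
  have hamgm : ∀ x, √(u₁ x * u₂ x) ≤ (u₁ x + u₂ x) / 2 := by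
    intro x
    refine Real.sqrt_le_iff.2 ⟨by linarith [hp₁ x, hp₂ x], ?_⟩
    nlinarith [sq_nonneg (u₁ x - u₂ x)]
  have hmean : ∫⁻ x, ENNReal.ofReal ((u₁ x + u₂ x) / 2) = objective t₂ g₂ := by
    have : ∀ x, ENNReal.ofReal ((u₁ x + u₂ x) / 2) =
        2⁻¹ * (ENNReal.ofReal (u₁ x) + ENNReal.ofReal (u₂ x)) := by
      intro x
      rw [← ENNReal.ofReal_add (hp₁ x).le (hp₂ x).le, div_eq_inv_mul,
        ENNReal.ofReal_mul (by norm_num), ENNReal.ofReal_inv_of_pos two_pos, ENNReal.ofReal_ofNat]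
    simp_rw [this]
    rw [lintegral_const_mul' _ _ (by simp),
      lintegral_add_left (continuous_integrand t₁ g₁).measurable]
    change 2⁻¹ * (objective t₁ g₁ + objective t₂ g₂) = _
    rw [heq, ← two_mul, ← mul_assoc, ENNReal.inv_mul_cancel two_ne_zero (by simp), one_mul]
  have hcont₁ : Continuous u₁ :=
    continuous_const.mul (Real.continuous_exp.comp (continuous_eval_mvPolynomial g₁).neg)
  have hcont₂ : Continuous u₂ :=
    continuous_const.mul (Real.continuous_exp.comp (continuous_eval_mvPolynomial g₂).neg)
  have hobj : objective √(t₁ * t₂) g = ∫⁻ x, ENNReal.ofReal √(u₁ x * u₂ x) :=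
    lintegral_congr fun x => by rw [hgeo]
  have hle : ∫⁻ x, ENNReal.ofReal √(u₁ x * u₂ x) ≤ objective t₂ g₂ := by
    rw [← hmean]
    exact lintegral_mono fun x => ENNReal.ofReal_le_ofReal (hamgm x)
  -- Minimality forces equal integrals in AM-GM; as they are finite, equality holds almost
  -- everywhere, then everywhere by continuity.
  have hae := ae_eq_of_ae_le_of_lintegral_le
    (f := fun x => ENNReal.ofReal √(u₁ x * u₂ x))
    (g := fun x => ENNReal.ofReal ((u₁ x + u₂ x) / 2)) (μ := volume)
    (Filter.Eventually.of_forall fun x => ENNReal.ofReal_le_ofReal (hamgm x))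
    (hle.trans_lt hfin).ne (by fun_prop) (by rw [hmean, ← hobj]; exact h₂.le _ _ hmid)
  have hfun := (Continuous.ae_eq_iff_eq volume
    (ENNReal.continuous_ofReal.comp (by fun_prop))
    (ENNReal.continuous_ofReal.comp (by fun_prop))).1 hae
  have hu : ∀ x, u₁ x = u₂ x := by
    intro x
    have hx := congrFun hfun x
    rw [Function.comp_apply, Function.comp_apply, ENNReal.ofReal_eq_ofReal_iff (Real.sqrt_nonneg _)
      (by linarith [hp₁ x, hp₂ x])] at hx
    have h2 := Real.sq_sqrt (mul_pos (hp₁ x) (hp₂ x)).le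
    rw [hx] at h2
    have : (u₁ x - u₂ x) ^ 2 = 0 := by linear_combination 4 * h2
    exact sub_eq_zero.1 (pow_eq_zero_iff two_ne_zero |>.1 this)
  have ht : t₁ = t₂ := by
    have h0 := hu 0
    simpa only [hu₁, hu₂, eval_zero_of_homogeneous hd0 h₁.feasible.homogeneous,
      eval_zero_of_homogeneous hd0 h₂.feasible.homogeneous, neg_zero, Real.exp_zero,
      mul_one] using h0
  refine ⟨ht, MvPolynomial.funext fun x => ?_⟩
  have hx := hu x
  simp only [hu₁, hu₂, ht] at hx
  exact neg_injective (Real.exp_injective (mul_left_cancel₀ (by linarith) hx))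

theorem theorem2 (n d : ℕ) (hd : Even d) (hd0 : 0 < d)
    (f : (Fin n → ℝ) → ℝ) (hf : IsLogConcave f)
    (hsup : IsLUB (Set.range f) 1) (hf0 : f 0 = 1)
    (hint : 0 < ∫⁻ x, ENNReal.ofReal (f x))
    (hbdd : Bornology.IsBounded (hatH1 d f)) :
    ∃ t₂ : ℝ, ∃ g₂ : MvPolynomial (Fin n) ℝ,
      1 ≤ t₂ ∧ g₂ ∈ finiteVolumeForms n d ∧ IsMinimizer d f t₂ g₂ ∧
      ∀ (t : ℝ) (g : MvPolynomial (Fin n) ℝ), IsMinimizer d f t g → t = t₂ ∧ g = g₂ := by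
  have hle : ∀ x, f x ≤ 1 := fun x => hsup.1 (mem_range_self x)
  obtain ⟨x₀, r, hr, c, hc, hfc⟩ := hf.exists_closedBall_le hint
  obtain ⟨h, hfeas, hfin⟩ := exists_isFeasible_objective_lt_top hd hd0 hle hbdd
  obtain ⟨t, g, hmin⟩ := exists_isMinimizer hd0 hr hc hfc hfeas hfin
  have hobj : objective t g < ∞ := (hmin.le _ _ hfeas).trans_lt hfin
  exact ⟨t, g, hmin.feasible.one_le, ⟨hmin.feasible.homogeneous,
    volume_lt_top_of_objective_lt_top hmin.feasible.one_le hobj 1 fun _ hx => hx⟩, hmin,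
    fun s k hs => hs.eq_of_objective_lt_top hd0 hf.nonneg hmin hobj⟩
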